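/- Let $\mathcal H$ be a separable complex Hilbert space and let $h$ be a self-adjoint operator on $\mathcal H$ with compact resolvent, with an orthonormal basis of eigenvectors $(\psi_j)_{j\in\mathcal J}$, $h\psi_j=e_j\psi_j$, the eigenvalues $e_j$ being listed in increasing order and repeated according to multiplicity, with $\mathcal J=\mathbb N$ or $\mathcal J=\{1,\dots,\dim\mathcal H\}$. Let $\mathcal H_N=\mathcal H^{\otimes N}$ and $H_N=\sum_{j=1}^N h_j$, where $h_j$ is $h$ acting on the $j$-th factor. For $\alpha\in\mathcal J^N$ put $\Psi_\alpha=\psi_{\alpha_1}\otimes\cdots\otimes\psi_{\alpha_N}$ and $E_\alpha=\sum_{j=1}^N e_{\alpha_j}$. For $E\in\mathrm{Spec}(H_N)$ let $P_E$ be the orthogonal projection onto the eigenspace of $H_N$ at $E$, and let the energy algebra $\mathcal A_N$ be the set of bounded operators $f(H_N)=\sum_{E\in\mathrm{Spec}(H_N)}f(E)P_E$ with $f$ bounded and continuous on $\mathrm{Spec}(H_N)$. A collision specification $(\mathcal C,U,\nu)$ consists of a compact metric space $\mathcal C$, a continuous one-to-one map $U$ from $\mathcal C$ to the unitary operators on $\mathcal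 H_2$, and a Borel probability measure $\nu$ on $\mathcal C$ that charges all nonempty open sets, such that: (i) each $U(\sigma)$ commutes with $H_2$; (ii) $U(\sigma_0)=1$ for some $\sigma_0$; (iii) $\{U(\sigma)\}=\{U(\sigma)^*\}$, and the map $\sigma\mapsto\sigma'$ with $U(\sigma')=U(\sigma)^*$ is measurable and preserves $\nu$; (iv) with $V(\phi\otimes\psi)=\psi\otimes\phi$, $\{U(\sigma)\}=\{VU(\sigma)V^*\}$, and the map $\sigma\mapsto\sigma'$ with $U(\sigma')=VU(\sigma)V^*$ is measurable and preserves $\nu$. It is ergodic if the commutant of $\{U(\sigma):\sigma\in\mathcal C\}$ is $\mathcal A_2$. For $i<j$ let $U_{i,j}(\sigma)$ be $U(\sigma)$ acting on the factors $i,j$ of $\mathcal H_N$, and let $\mathscr C_N$ be the commutant of $\{U_{i,j}(\sigma): 1\le i<j\le N,\ \sigma\in\mathcal C\}$. A nonzero orthogonal projection $P\in\mathscr C_N$ is minimal if every nonzero orthogonal projection $Q\in\mathscr C_N$ with $Q\le P$ equals $P$. An ergodic collision specification is fully ergodic (for $N$ particles) if $P_E$ is minimal in $\mathscr C_N$ for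 each $E\in\mathrm{Spec}(H_N)$. Indices $\alpha,\alpha'\in\mathcal J^N$ are adjacent if for some $i<j$ one has $e_{\alpha_i}+e_{\alpha_j}=e_{\alpha'_i}+e_{\alpha'_j}$ and $\alpha_k=\alpha'_k$ for all $k\ne i,j$; they are equivalent, $\alpha\sim\alpha'$, if they are joined by a finite chain of successively adjacent indices. Let $(\mathcal C,U,\nu)$ be an ergodic collision specification and let $N\ge2$. Then: 1. Each equivalence class is finite. For each $E\in\mathrm{Spec}(H_N)$, the minimal projections $P$ in $\mathscr C_N$ with $P\le P_E$ are precisely the operators $P=\sum_{\alpha\sim\alpha_0}|\Psi_\alpha\rangle\langle\Psi_\alpha|$ for some $\alpha_0\in\mathcal J^N$ with $H_N\Psi_{\alpha_0}=E\Psi_{\alpha_0}$. 2. Each minimal projection in $\mathscr C_N$ satisfies $P\le P_E$ for some $E\in\mathrm{Spec}(H_N)$, and $c\mapsto\sum_{\alpha\in c}|\Psi_\alpha\rangle\langle\Psi_\alpha|$ is a bijection from the set of equivalence classes in $\mathcal J^N$ onto the set of minimal projections in $\mathscr C_N$. 3. The following are equivalent: the collision specification is fully ergodic for $N$ particles; $\mathscr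 C_N=\mathcal A_N$; and, whenever $\alpha,\alpha'\in\mathcal J^N$ satisfy $E_\alpha=E_{\alpha'}$, one has $\alpha\sim\alpha'$. -/

import Mathlib

open scoped InnerProductSpace

noncomputable section

namespace QuantumKac

/-! ### The Hilbert tensor power

The tensor power `𝓗^{⊗N}` of a Hilbert space `𝓗` with orthonormal basis `(ψ_j)_{j ∈ J}` is realised
as `ℓ²(J^N)`: a vector is given by its coordinates in the orthonormal basis
`ψ_{α_1} ⊗ ⋯ ⊗ ψ_{α_N}`. -/

/-- The `N`-fold Hilbert tensor power, in coordinates. -/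
abbrev TensorPower (J : Type*) (N : ℕ) : Type _ :=
  lp (fun _ : Fin N → J => ℂ) 2

theorem enorm_sq_eq_tsum {A : Type*} (f : lp (fun _ : A => ℂ) 2) :
    ‖f‖ₑ ^ 2 = ∑' a, ‖f a‖ₑ ^ 2 := by
  have h2 : (0 : ℝ) < (2 : ENNReal).toReal := by norm_num
  have hs : HasSum (fun a => ‖f a‖ ^ 2) (‖f‖ ^ 2) := by
    have := lp.hasSum_norm h2 f
    simpa using this
  have e1 : ‖f‖ₑ ^ 2 = ENNReal.ofReal (‖f‖ ^ 2) := by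
    rw [ENNReal.ofReal_pow (norm_nonneg _), ofReal_norm]
  rw [e1, ← hs.tsum_eq, ENNReal.ofReal_tsum_of_nonneg (fun _ => by positivity) hs.summable]
  refine tsum_congr fun a => ?_
  rw [ENNReal.ofReal_pow (norm_nonneg _), ofReal_norm]

theorem memlp_of_tsum_enorm {A : Type*} {f : A → ℂ} {c : ENNReal} (hc : c ≠ ⊤)
    (h : ∑' a, ‖f a‖ₑ ^ 2 ≤ c) : Memℓp f 2 := by
  refine memℓp_gen ?_
  have h' : ∑' a, ENNReal.ofReal (‖f a‖ ^ 2) ≠ ⊤ := by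
    refine ne_top_of_le_ne_top hc (le_trans (le_of_eq (tsum_congr fun a => ?_)) h)
    rw [ENNReal.ofReal_pow (norm_nonneg _), ofReal_norm]
  have := ENNReal.summable_toReal h'
  refine this.congr fun a => ?_
  rw [ENNReal.toReal_ofReal (by positivity)]
  simp

theorem norm_le_of_enorm_sq {E F : Type*} [NormedAddCommGroup E] [NormedAddCommGroup F]
    {x : E} {y : F} {c : ℝ} (hc : 0 ≤ c) (h : ‖x‖ₑ ^ 2 ≤ ENNReal.ofReal c ^ 2 * ‖y‖ₑ ^ 2) :
    ‖x‖ ≤ c * ‖y‖ := by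
  have h1 : ENNReal.ofReal (‖x‖ ^ 2) ≤ ENNReal.ofReal ((c * ‖y‖) ^ 2) := by
    rw [ENNReal.ofReal_pow (norm_nonneg _), ofReal_norm, ENNReal.ofReal_pow (by positivity),
      ENNReal.ofReal_mul hc, ofReal_norm, mul_pow]
    exact h
  rw [ENNReal.ofReal_le_ofReal_iff (by positivity)] at h1
  exact le_of_sq_le_sq h1 (by positivity)

/-- Composition with an injective map of the index sets, `f ↦ f ∘ g`. -/
def pull {A B : Type*} (g : A → B) (hg : Function.Injective g) :
    lp (fun _ : B => ℂ) 2 →L[ℂ] lp (fun _ : A => ℂ) 2 :=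
  have key : ∀ f : lp (fun _ : B => ℂ) 2, ∑' a, ‖f (g a)‖ₑ ^ 2 ≤ ‖f‖ₑ ^ 2 := fun f => by
    rw [enorm_sq_eq_tsum]
    exact ENNReal.tsum_comp_le_tsum_of_injective hg fun b => ‖f b‖ₑ ^ 2
  LinearMap.mkContinuous
    { toFun := fun f => ⟨fun a => f (g a), memlp_of_tsum_enorm (by simp) (key f)⟩
      map_add' := fun _ _ => rfl
      map_smul' := fun _ _ => rfl } 1 (fun f => by
        refine norm_le_of_enorm_sq zero_le_one ?_
        rw [enorm_sq_eq_tsum, ENNReal.ofReal_one, one_pow, one_mul]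
        exact key f)

@[simp] theorem pull_apply {A B : Type*} (g : A → B) (hg : Function.Injective g)
    (f : lp (fun _ : B => ℂ) 2) (a : A) : pull g hg f a = f (g a) := rfl

/-- The multi-index obtained from `α` by replacing its `i`-th entry by `β 0` and its `j`-th entry
by `β 1`. -/
def insertPair {J : Type*} {N : ℕ} (i j : Fin N) (α : Fin N → J) (β : Fin 2 → J) : Fin N → J :=
  Function.update (Function.update α i (β 0)) j (β 1)

theorem insertPair_injective {J : Type*} {N : ℕ} {i j : Fin N} (hij : i ≠ j) (α : Fin N → J) :
    Function.Injective (insertPair i j α) := by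
  intro β β' h
  have h0 := congrFun h i
  have h1 := congrFun h j
  simp only [insertPair, Function.update_self, Function.update_of_ne hij] at h0 h1
  funext k
  fin_cases k
  · exact h0
  · exact h1

/-- A multi-index is the same as its `i`-th and `j`-th entries and the remaining entries. -/
def splitPair {J : Type*} {N : ℕ} {i j : Fin N} (hij : i ≠ j) :
    ({k : Fin N // k ≠ i ∧ k ≠ j} → J) × (Fin 2 → J) ≃ (Fin N → J) where
  toFun p k := if hi : k = i then p.2 0 else if hj : k = j then p.2 1 else p.1 ⟨k, hi, hj⟩
  invFun α := (fun k => α k, ![α i, α j])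
  left_inv p := by
    refine Prod.ext (funext fun k => ?_) (funext fun k => ?_)
    · simp [k.2.1, k.2.2]
    · fin_cases k <;> simp [hij.symm]
  right_inv α := by
    funext k
    by_cases hi : k = i
    · subst hi; simp
    · by_cases hj : k = j
      · subst hj; simp [hi]
      · simp [hi, hj]

theorem tsum_pairOp_le {J : Type*} {N : ℕ} {i j : Fin N} (hij : i ≠ j)
    (B : TensorPower J 2 →L[ℂ] TensorPower J 2) (f : TensorPower J N) :
    ∑' α : Fin N → J, ‖B (pull (insertPair i j α) (insertPair_injective hij α) f) ![α i, α j]‖ₑ ^ 2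
      ≤ ‖B‖ₑ ^ 2 * ‖f‖ₑ ^ 2 := by
  have hins : ∀ (r : {k : Fin N // k ≠ i ∧ k ≠ j} → J) (β β' : Fin 2 → J),
      insertPair i j (splitPair hij (r, β)) β' = splitPair hij (r, β') := by
    intro r β β'
    funext k
    by_cases hi : k = i
    · subst hi; simp [insertPair, splitPair, hij]
    · by_cases hj : k = j
      · subst hj; simp [insertPair, splitPair, hi]
      · simp [insertPair, splitPair, hi, hj]
  have hsi : ∀ r : {k : Fin N // k ≠ i ∧ k ≠ j} → J,
      Function.Injective fun β : Fin 2 → J => splitPair hij (r, β) := fun r β β' h => by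
    simpa using (splitPair hij).injective h
  have hpr : ∀ (r : {k : Fin N // k ≠ i ∧ k ≠ j} → J) (β : Fin 2 → J),
      ![splitPair hij (r, β) i, splitPair hij (r, β) j] = β := by
    intro r β
    funext k
    fin_cases k <;> simp [splitPair, hij.symm]
  have hterm : ∀ (r : {k : Fin N // k ≠ i ∧ k ≠ j} → J) (β : Fin 2 → J),
      pull (insertPair i j (splitPair hij (r, β))) (insertPair_injective hij _) f
        = pull _ (hsi r) f := by
    intro r β
    refine lp.ext (funext fun β' => ?_)
    simp [hins]
  rw [← (splitPair hij).tsum_eq, ENNReal.tsum_prod', enorm_sq_eq_tsum f,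
    ← (splitPair hij).tsum_eq (fun α => ‖f α‖ₑ ^ 2), ENNReal.tsum_prod', ← ENNReal.tsum_mul_left]
  refine ENNReal.tsum_le_tsum fun r => ?_
  have e1 : ∑' β : Fin 2 → J, ‖B (pull (insertPair i j (splitPair hij (r, β)))
      (insertPair_injective hij _) f)
        ![splitPair hij (r, β) i, splitPair hij (r, β) j]‖ₑ ^ 2 = ‖B (pull _ (hsi r) f)‖ₑ ^ 2 := by
    rw [enorm_sq_eq_tsum]
    refine tsum_congr fun β => ?_
    rw [hterm, hpr]
  have e2 : ∑' β : Fin 2 → J, ‖f (splitPair hij (r, β))‖ₑ ^ 2 = ‖pull _ (hsi r) f‖ₑ ^ 2 := by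
    rw [enorm_sq_eq_tsum]
    rfl
  rw [e1, e2, ← mul_pow]
  gcongr
  exact B.le_opENorm _

/-- The operator on the `N`-fold tensor power that applies the two-particle operator `B` to the
factors `i` and `j` (in this order) and is the identity on the other factors. -/
def pairOp {J : Type*} {N : ℕ} (i j : Fin N) (hij : i ≠ j)
    (B : TensorPower J 2 →L[ℂ] TensorPower J 2) : TensorPower J N →L[ℂ] TensorPower J N :=
  LinearMap.mkContinuous
    { toFun := fun f =>
        ⟨fun α => B (pull (insertPair i j α) (insertPair_injective hij α) f) ![α i, α j],
          memlp_of_tsum_enorm (ENNReal.mul_ne_top (by simp) (by simp)) (tsum_pairOp_le hij B f)⟩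
      map_add' := fun f g => by
        refine lp.ext (funext fun α => ?_)
        simp only [map_add, lp.coeFn_add, Pi.add_apply]
      map_smul' := fun c f => by
        refine lp.ext (funext fun α => ?_)
        simp only [map_smul, lp.coeFn_smul, Pi.smul_apply]
        rfl } ‖B‖ (fun f => by
        refine norm_le_of_enorm_sq (norm_nonneg _) ?_
        rw [enorm_sq_eq_tsum, ofReal_norm]
        exact tsum_pairOp_le hij B f)

theorem pairOp_apply {J : Type*} {N : ℕ} (i j : Fin N) (hij : i ≠ j)
    (B : TensorPower J 2 →L[ℂ] TensorPower J 2) (f : TensorPower J N) (α : Fin N → J) :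
    pairOp i j hij B f α =
      B (pull (insertPair i j α) (insertPair_injective hij α) f) ![α i, α j] := rfl

/-- The swap `φ ⊗ χ ↦ χ ⊗ φ` on the two-fold tensor power. -/
def swapOp (J : Type*) : TensorPower J 2 →L[ℂ] TensorPower J 2 :=
  pull (fun β => β ∘ Equiv.swap 0 1) (Equiv.swap (0 : Fin 2) 1).surjective.injective_comp_right

section ProductVectors

variable {H : Type*} [NormedAddCommGroup H] [InnerProductSpace ℂ H] {J : Type*}

theorem summable_prod_coord {N : ℕ} (a : Fin N → J → ℝ) (h0 : ∀ i j, 0 ≤ a i j)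
    (hs : ∀ i, Summable (a i)) : Summable fun α : Fin N → J => ∏ i, a i (α i) := by
  classical
  refine summable_of_sum_le (c := ∏ i, ∑' j, a i j)
    (fun α => Finset.prod_nonneg fun i _ => h0 i _) fun s => ?_
  calc ∑ α ∈ s, ∏ i, a i (α i)
      ≤ ∑ α ∈ Fintype.piFinset (fun i => s.image fun α => α i), ∏ i, a i (α i) := by
        refine Finset.sum_le_sum_of_subset_of_nonneg (fun α hα => ?_)
          fun α _ _ => Finset.prod_nonneg fun i _ => h0 i _
        rw [Fintype.mem_piFinset]
        exact fun i => Finset.mem_image_of_mem _ hα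
    _ = ∏ i, ∑ j ∈ s.image (fun α => α i), a i j := (Finset.prod_univ_sum _ _).symm
    _ ≤ ∏ i, ∑' j, a i j := Finset.prod_le_prod
        (fun i _ => Finset.sum_nonneg fun j _ => h0 i j)
        fun i _ => (hs i).sum_le_tsum _ fun j _ => h0 i j

/-- The product vector `φ_1 ⊗ ⋯ ⊗ φ_N`, with coordinates `∏ i, ⟪ψ_{α_i}, φ_i⟫`. -/
def tprod (ψ : HilbertBasis J ℂ H) {N : ℕ} (φ : Fin N → H) : TensorPower J N :=
  ⟨fun α => ∏ i, ⟪ψ (α i), φ i⟫_ℂ, memℓp_gen (by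
    have := summable_prod_coord (fun i j => ‖⟪ψ j, φ i⟫_ℂ‖ ^ 2) (fun _ _ => by positivity)
      (fun i => by
        have h := lp.hasSum_norm (p := 2) (by norm_num) (ψ.repr (φ i))
        simpa [ψ.repr_apply_apply] using h.summable)
    refine this.congr fun α => ?_
    simp [norm_prod, Finset.prod_pow])⟩

theorem tprod_apply (ψ : HilbertBasis J ℂ H) {N : ℕ} (φ : Fin N → H) (α : Fin N → J) :
    tprod ψ φ α = ∏ i, ⟪ψ (α i), φ i⟫_ℂ := rfl

/-- The defining property of the Hilbert tensor product on product vectors. -/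
theorem inner_tprod (ψ : HilbertBasis J ℂ H) {N : ℕ} (φ χ : Fin N → H) :
    ⟪tprod ψ φ, tprod ψ χ⟫_ℂ = ∏ i, ⟪φ i, χ i⟫_ℂ := by
  classical
  have h1 := lp.hasSum_inner (𝕜 := ℂ) (tprod ψ φ) (tprod ψ χ)
  have hT : Filter.Tendsto (fun s : Finset J => Fintype.piFinset fun _ : Fin N => s)
      Filter.atTop Filter.atTop := by
    refine Filter.tendsto_atTop_finset_of_monotone
      (fun s t hst => Fintype.piFinset_subset _ _ fun _ => hst) fun α => ?_
    exact ⟨Finset.univ.image α, by simp [Fintype.mem_piFinset]⟩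
  have h2 := Filter.Tendsto.comp h1 hT
  have h3 : Filter.Tendsto
      (fun s : Finset J => ∏ i : Fin N, ∑ j ∈ s, ⟪φ i, ψ j⟫_ℂ * ⟪ψ j, χ i⟫_ℂ)
      Filter.atTop (nhds (∏ i, ⟪φ i, χ i⟫_ℂ)) :=
    tendsto_finsetProd _ fun i _ => ψ.hasSum_inner_mul_inner (φ i) (χ i)
  refine tendsto_nhds_unique h2 (h3.congr fun s => ?_)
  rw [Finset.prod_univ_sum]
  refine Finset.sum_congr rfl fun α _ => ?_
  simp [tprod_apply, Finset.prod_mul_distrib, mul_comm]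

/-- `pairOp` acts on product vectors as it should: the coordinates of
`(B (φ_i ⊗ φ_j)) ⊗ (the other factors)`. -/
theorem pairOp_tprod (ψ : HilbertBasis J ℂ H) {N : ℕ} (i j : Fin N) (hij : i ≠ j)
    (B : TensorPower J 2 →L[ℂ] TensorPower J 2) (φ : Fin N → H) (α : Fin N → J) :
    pairOp i j hij B (tprod ψ φ) α = B (tprod ψ ![φ i, φ j]) ![α i, α j] *
      ∏ k ∈ (Finset.univ.erase i).erase j, ⟪ψ (α k), φ k⟫_ℂ := by
  have : pull (insertPair i j α) (insertPair_injective hij α) (tprod ψ φ) =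
      (∏ k ∈ (Finset.univ.erase i).erase j, ⟪ψ (α k), φ k⟫_ℂ) • tprod ψ ![φ i, φ j] := by
    refine lp.ext (funext fun β => ?_)
    simp only [pull_apply, tprod_apply, lp.coeFn_smul, Pi.smul_apply, smul_eq_mul,
      Fin.prod_univ_two]
    rw [← Finset.mul_prod_erase Finset.univ _ (Finset.mem_univ i),
      ← Finset.mul_prod_erase (Finset.univ.erase i) _
        (Finset.mem_erase.mpr ⟨hij.symm, Finset.mem_univ j⟩)]
    have e : ∏ k ∈ (Finset.univ.erase i).erase j, ⟪ψ (insertPair i j α β k), φ k⟫_ℂ =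
        ∏ k ∈ (Finset.univ.erase i).erase j, ⟪ψ (α k), φ k⟫_ℂ := by
      refine Finset.prod_congr rfl fun k hk => ?_
      simp only [Finset.mem_erase] at hk
      simp [insertPair, hk.1, hk.2.1]
    rw [e]
    simp [insertPair, hij]
    ring
  rw [pairOp_apply, this, map_smul]
  simp [lp.coeFn_smul, mul_comm]

end ProductVectors

/-! ### Unbounded operators through their graphs -/

section Graphs

variable {K : Type*} [NormedAddCommGroup K] [InnerProductSpace ℂ K]

/-- `R` is the resolvent `(z - T)⁻¹` of the operator `T` with graph `G`: it is bounded and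
everywhere defined, maps into the domain of `T`, and is a two-sided inverse of `z - T`. -/
def IsResolventAt (G : Submodule ℂ (K × K)) (z : ℂ) (R : K →L[ℂ] K) : Prop :=
  (∀ w, (R w, z • R w - w) ∈ G) ∧ ∀ x y, (x, y) ∈ G → R (z • x - y) = x

/-- The spectrum of the operator with graph `G`. -/
def graphSpectrum (G : Submodule ℂ (K × K)) : Set ℂ :=
  {z | ¬ ∃ R : K →L[ℂ] K, IsResolventAt G z R}

/-- The eigenspace `{x | T x = z x}` of the operator `T` with graph `G`. -/
def graphEigenspace (G : Submodule ℂ (K × K)) (z : ℂ) : Submodule ℂ K :=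
  G.comap (LinearMap.prod LinearMap.id (z • LinearMap.id))

end Graphs

/-! ### The system -/

/-- A single-particle Hamiltonian `h`, a self-adjoint operator with compact resolvent on the Hilbert
space `H`, with its eigenvalues `(e_j)` in increasing order, repeated according to multiplicity, and
an orthonormal basis `(ψ_j)` of eigenvectors, `h ψ_j = e_j ψ_j`.  The index set `J` is a linear order
all of whose initial segments `{j | j ≤ a}` are finite, that is, a copy of `ℕ` or of some
`{1, …, n}`. -/
structure SingleParticle (H : Type*) [NormedAddCommGroup H] [InnerProductSpace ℂ H]
    [CompleteSpace H] (J : Type*) [LinearOrder J] [LocallyFiniteOrderBot J] where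
  /-- the single-particle Hamiltonian, possibly unbounded -/
  h : H →ₗ.[ℂ] H
  selfAdjoint : IsSelfAdjoint h
  compactResolvent : ∃ (z : ℂ) (R : H →L[ℂ] H), IsResolventAt h.graph z R ∧ IsCompactOperator R
  /-- the eigenvalues -/
  e : J → ℝ
  monotone_e : Monotone e
  /-- the eigenbasis -/
  ψ : HilbertBasis J ℂ H
  eigen : ∀ j, (ψ j, (e j : ℂ) • ψ j) ∈ h.graph

namespace SingleParticle

variable {H : Type*} [NormedAddCommGroup H] [InnerProductSpace ℂ H] [CompleteSpace H]
  {J : Type*} [LinearOrder J] [LocallyFiniteOrderBot J] (S : SingleParticle H J)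

/-- The energy `E_α = ∑ e_{α_j}`. -/
def energy {N : ℕ} (α : Fin N → J) : ℝ := ∑ j, S.e (α j)

/-- The vector `Ψ_α = ψ_{α_1} ⊗ ⋯ ⊗ ψ_{α_N}`. -/
def Ψ {N : ℕ} (α : Fin N → J) : TensorPower J N := tprod S.ψ fun i => S.ψ (α i)

/-- The graph of the `N`-particle Hamiltonian `H_N = ∑_j h_j`, the closure of the operator that maps
`φ_1 ⊗ ⋯ ⊗ φ_N`, with all `φ_j` in the domain of `h`, to
`∑_j φ_1 ⊗ ⋯ ⊗ h φ_j ⊗ ⋯ ⊗ φ_N`. -/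
def hamiltonian (N : ℕ) : Submodule ℂ (TensorPower J N × TensorPower J N) :=
  (Submodule.span ℂ {p | ∃ φ : Fin N → S.h.domain,
    p = (tprod S.ψ fun i => (φ i : H),
      ∑ j, tprod S.ψ (Function.update (fun i => (φ i : H)) j (S.h (φ j))))}).topologicalClosure

/-- The energy shell at `E`. -/
def energyShell (N : ℕ) (E : ℂ) : Submodule ℂ (TensorPower J N) :=
  graphEigenspace (S.hamiltonian N) E

instance completeSpace_energyShell (N : ℕ) (E : ℂ) : CompleteSpace (S.energyShell N E) := by
  refine IsClosed.completeSpace_coe (hs := ?_)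
  have hc : IsClosed (S.hamiltonian N : Set (TensorPower J N × TensorPower J N)) :=
    Submodule.isClosed_topologicalClosure _
  exact hc.preimage (f := fun x : TensorPower J N => (x, E • x)) (by fun_prop)

/-- The orthogonal projection `P_E` onto the energy shell at `E`. -/
def energyProj (N : ℕ) (E : ℂ) : TensorPower J N →L[ℂ] TensorPower J N :=
  (S.energyShell N E).starProjection

/-- The spectrum of `H_N`. -/
def spec (N : ℕ) : Set ℂ := graphSpectrum (S.hamiltonian N)

/-- The energy algebra `𝒜_N`: the operators `∑_{E ∈ Spec(H_N)} f(E) P_E` (strong convergence) with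
`f` bounded and continuous on `Spec(H_N)`. -/
def energyAlgebra (N : ℕ) : Set (TensorPower J N →L[ℂ] TensorPower J N) :=
  {A | ∃ f : BoundedContinuousFunction (S.spec N) ℂ,
    ∀ x, HasSum (fun E : S.spec N => f E • S.energyProj N E x) (A x)}

/-- Adjacency of multi-indices. -/
def Adjacent {N : ℕ} (α α' : Fin N → J) : Prop :=
  ∃ i j : Fin N, i < j ∧ S.e (α i) + S.e (α j) = S.e (α' i) + S.e (α' j) ∧
    ∀ k, k ≠ i → k ≠ j → α k = α' k

/-- Equivalence of multi-indices: they are joined by a finite chain of adjacent ones. -/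
def indexSetoid (N : ℕ) : Setoid (Fin N → J) where
  r := Relation.ReflTransGen S.Adjacent
  iseqv :=
    { refl := fun _ => .refl
      symm := fun h => by
        induction h with
        | refl => exact .refl
        | tail _ hbc ih =>
          obtain ⟨i, j, hij, he, hk⟩ := hbc
          exact .head ⟨i, j, hij, he.symm, fun k hi hj => (hk k hi hj).symm⟩ ih
      trans := fun h h' => h.trans h' }

/-- The operator `∑_{α ∈ c} |Ψ_α⟩⟨Ψ_α|` for a finite set `c` of multi-indices. -/
def indexProj {N : ℕ} (c : Set (Fin N → J)) : TensorPower J N →L[ℂ] TensorPower J N :=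
  ∑ᶠ α ∈ c, InnerProductSpace.rankOne ℂ (S.Ψ α) (S.Ψ α)

end SingleParticle

/-- `P` is a minimal projection of the operator algebra `𝒞`. -/
def IsMinimalProjection {K : Type*} [NormedAddCommGroup K] [InnerProductSpace ℂ K]
    [CompleteSpace K] (𝒞 : Set (K →L[ℂ] K)) (P : K →L[ℂ] K) : Prop :=
  P ∈ 𝒞 ∧ IsStarProjection P ∧ P ≠ 0 ∧
    ∀ Q ∈ 𝒞, IsStarProjection Q → Q ≠ 0 → Q ≤ P → Q = P

/-- A collision specification `(C, U, ν)` with parameter space the compact metric space `C`. Of the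
map `U` only strong continuity is required, which norm continuity implies. -/
structure CollisionSpecification {H : Type*} [NormedAddCommGroup H] [InnerProductSpace ℂ H]
    [CompleteSpace H] {J : Type*} [LinearOrder J] [LocallyFiniteOrderBot J]
    (S : SingleParticle H J) (C : Type*) [MetricSpace C] [CompactSpace C] [MeasurableSpace C]
    [BorelSpace C] where
  /-- the collision operators -/
  U : C → unitary (TensorPower J 2 →L[ℂ] TensorPower J 2)
  continuous_U : ∀ x : TensorPower J 2,
    Continuous fun σ => (U σ : TensorPower J 2 →L[ℂ] TensorPower J 2) x
  injective_U : Function.Injective U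
  /-- the distribution of the collision parameter -/
  ν : MeasureTheory.Measure C
  isProbabilityMeasure : MeasureTheory.IsProbabilityMeasure ν
  isOpenPosMeasure : ν.IsOpenPosMeasure
  /-- each `U σ` commutes with `H_2`, that is, `U σ` maps the graph of `H_2` onto itself -/
  commutes : ∀ σ x y, (x, y) ∈ S.hamiltonian 2 ↔
    ((U σ : TensorPower J 2 →L[ℂ] TensorPower J 2) x,
      (U σ : TensorPower J 2 →L[ℂ] TensorPower J 2) y) ∈ S.hamiltonian 2
  exists_one : ∃ σ₀, U σ₀ = 1
  /-- time reversal -/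
  reversal : ∃ τ : C → C, (∀ σ, U (τ σ) = star (U σ)) ∧ MeasureTheory.MeasurePreserving τ ν ν
  /-- exchange of the two particles -/
  exchange : ∃ τ : C → C,
    (∀ σ, (U (τ σ) : TensorPower J 2 →L[ℂ] TensorPower J 2) =
      swapOp J * (U σ : TensorPower J 2 →L[ℂ] TensorPower J 2) * star (swapOp J)) ∧
    MeasureTheory.MeasurePreserving τ ν ν

namespace CollisionSpecification

variable {H : Type*} [NormedAddCommGroup H] [InnerProductSpace ℂ H] [CompleteSpace H]
  {J : Type*} [LinearOrder J] [LocallyFiniteOrderBot J] {S : SingleParticle H J}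
  {C : Type*} [MetricSpace C] [CompactSpace C] [MeasurableSpace C] [BorelSpace C]
  (K : CollisionSpecification S C)

/-- Ergodicity: the commutant of `{U σ}` is the energy algebra `𝒜_2`. -/
def IsErgodic : Prop :=
  Set.centralizer (Set.range fun σ => (K.U σ : TensorPower J 2 →L[ℂ] TensorPower J 2)) =
    S.energyAlgebra 2

/-- The commutant `𝒞_N` of the collision operators `U_{i,j}(σ)`, `i < j`. -/
def commutant (N : ℕ) : Set (TensorPower J N →L[ℂ] TensorPower J N) :=
  Set.centralizer {T | ∃ (i j : Fin N) (hij : i < j) (σ : C), T = pairOp i j hij.ne (K.U σ)}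

/-- Full ergodicity of the `N`-particle system: ergodicity at each energy `E ∈ Spec(H_N)`, which
means that `P_E` is minimal in `𝒞_N`. -/
def IsFullyErgodic (N : ℕ) : Prop :=
  K.IsErgodic ∧ ∀ E ∈ S.spec N, IsMinimalProjection (K.commutant N) (S.energyProj N E)

end CollisionSpecification

end QuantumKac

end

/-! In the basis `Ψ_α` the Hamiltonian `H_N` is multiplication by `α ↦ E_α`, so the spectral
projections are diagonal and, the spectrum being discrete, the energy algebra consists of all
bounded diagonal operators that are constant on the level sets of the energy. An operator `T` on
`𝓗_N` commutes with the collisions of the factors `i, j` if and only if each of its blocks,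
obtained by fixing all other indices in the range and in the domain, commutes with the
two-particle collisions. By ergodicity each block is then diagonal and constant on two-particle
energy shells. Since `N ≥ 2`, two distinct multi-indices differ in some pair of places, so `T`
itself is diagonal; constancy on the shells of the blocks is constancy on adjacent indices. Hence
`𝒞_N` is the algebra of bounded diagonal operators that are constant on equivalence classes,
whose minimal projections are the indicators of the classes. -/

noncomputable section

namespace QuantumKac

open scoped lp

/-! ### Diagonal operators -/

section Diagonal

variable {A : Type*} {T T' : ℓ²(A, ℂ) →L[ℂ] ℓ²(A, ℂ)} {t t' : A → ℂ} {c d : Set A}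

theorem ext_single [DecidableEq A] {E : Type*} [NormedAddCommGroup E] [NormedSpace ℂ E]
    {f g : ℓ²(A, ℂ) →L[ℂ] E} (h : ∀ a, f (lp.single 2 a 1) = g (lp.single 2 a 1)) : f = g :=
  lp.ext_continuousLinearMap (by simp) fun a => ContinuousLinearMap.ext_ring (h a)

/-- `T` is the operator of multiplication by the function `t`, whose matrix in the standard basis
of `ℓ²(A)` is diagonal with entries `t a`. -/
def IsDiagonal (T : ℓ²(A, ℂ) →L[ℂ] ℓ²(A, ℂ)) (t : A → ℂ) : Prop :=
  ∀ x a, T x a = t a * x a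

theorem exists_isDiagonal (ht : Bornology.IsBounded (Set.range t)) : ∃ T, IsDiagonal T t := by
  obtain ⟨M, hM, htM⟩ := ht.exists_pos_norm_le
  refine ⟨lp.mapCLM 2 (fun a => t a • ContinuousLinearMap.id ℂ ℂ) hM.le fun a => ?_,
    fun x a => by simp⟩
  rw [norm_smul, ContinuousLinearMap.norm_id, mul_one]
  exact htM _ ⟨a, rfl⟩

theorem exists_isDiagonal_indicator (c : Set A) : ∃ T, IsDiagonal T (c.indicator 1) := by
  classical
  refine exists_isDiagonal (isBounded_iff_forall_norm_le.mpr ⟨1, ?_⟩)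
  rintro _ ⟨a, rfl⟩
  by_cases ha : a ∈ c <;> simp [ha]

theorem isDiagonal_of_forall_ne [DecidableEq A]
    (h : ∀ a b, a ≠ b → T (lp.single 2 b 1) a = 0) :
    IsDiagonal T fun a => T (lp.single 2 a 1) a := by
  intro x a
  let ev : ℓ²(A, ℂ) →L[ℂ] ℂ := lp.evalCLM ℂ (fun _ : A => ℂ) 2 a
  have key : ev.comp T = T (lp.single 2 a 1) a • ev := ext_single fun b => by
    change T (lp.single 2 b 1) a = T (lp.single 2 a 1) a * (lp.single 2 b 1 : ℓ²(A, ℂ)) a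
    rcases eq_or_ne a b with rfl | hab
    · simp
    · simp [h a b hab, hab]
  exact DFunLike.congr_fun key x

namespace IsDiagonal

theorem ext (h : IsDiagonal T t) (h' : IsDiagonal T' t) : T = T' :=
  ContinuousLinearMap.ext fun x => lp.ext <| funext fun a => by rw [h, h']

theorem mul (h : IsDiagonal T t) (h' : IsDiagonal T' t') : IsDiagonal (T * T') (t * t') :=
  fun x a => by rw [mul_apply_eq_comp, h, h', Pi.mul_apply, mul_assoc]

theorem apply_single [DecidableEq A] (h : IsDiagonal T t) (a : A) :
    T (lp.single 2 a 1) = lp.single 2 a (t a) :=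
  lp.ext <| funext fun b => by
    rw [h]
    rcases eq_or_ne b a with rfl | hb <;> simp [*]

theorem unique (h : IsDiagonal T t) (h' : IsDiagonal T t') : t = t' := by
  classical
  funext a
  have := h.apply_single a
  rw [h'.apply_single] at this
  simpa using (congrArg (fun x : ℓ²(A, ℂ) => x a) this).symm

theorem star (h : IsDiagonal T t) : IsDiagonal (star T) (star t) := by
  classical
  intro x a
  have adj := ContinuousLinearMap.adjoint_inner_right T (lp.single 2 a (1 : ℂ)) x
  rw [h.apply_single, lp.inner_single_left, lp.inner_single_left] at adj
  rw [ContinuousLinearMap.star_eq_adjoint]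
  simpa [mul_comm] using adj

theorem eq_iff (h : IsDiagonal T t) (h' : IsDiagonal T' t') : T = T' ↔ t = t' :=
  ⟨fun e => (e ▸ h).unique h', fun e => (e ▸ h).ext h'⟩

theorem norm_apply_le (h : IsDiagonal T t) (a : A) : ‖t a‖ ≤ ‖T‖ := by
  classical
  have hT := T.le_opNorm (lp.single 2 a 1)
  rwa [h.apply_single, lp.norm_single (by simp), lp.norm_single (by simp), norm_one,
    mul_one] at hT

theorem indicator_eq_iff (h : IsDiagonal T (c.indicator 1)) (h' : IsDiagonal T' (d.indicator 1)) :
    T = T' ↔ c = d :=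
  (h.eq_iff h').trans ⟨fun e => Set.indicator_one_inj ℂ e, fun e => e ▸ rfl⟩

theorem indicator_mul (h : IsDiagonal T (c.indicator 1)) (h' : IsDiagonal T' (d.indicator 1)) :
    IsDiagonal (T * T') ((c ∩ d).indicator 1) :=
  Set.inter_indicator_one (M₀ := ℂ) (s := c) (t := d) ▸ h.mul h'

theorem isStarProjection (h : IsDiagonal T (c.indicator 1)) : IsStarProjection T where
  isIdempotentElem := ((h.indicator_mul h).indicator_eq_iff h).mpr c.inter_self
  isSelfAdjoint := (h.star.eq_iff h).mpr <| funext fun a => by by_cases ha : a ∈ c <;> simp [ha]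

theorem eq_indicator_of_isStarProjection (h : IsDiagonal T t) (hT : IsStarProjection T) :
    t = {a | t a ≠ 0}.indicator 1 := by
  have idem : t * t = t := (h.mul h).unique (by rwa [hT.isIdempotentElem.eq])
  funext a
  by_cases ha : t a = 0
  · simp [ha]
  · simpa [ha] using congrFun idem a

theorem ne_zero_iff (h : IsDiagonal T (c.indicator 1)) : T ≠ 0 ↔ c.Nonempty := by
  have h0 : IsDiagonal 0 ((∅ : Set A).indicator 1) := fun x a => by simp
  rw [ne_eq, h.indicator_eq_iff h0, Set.nonempty_iff_ne_empty]

theorem le_iff (h : IsDiagonal T (c.indicator 1)) (h' : IsDiagonal T' (d.indicator 1)) :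
    T ≤ T' ↔ c ⊆ d := by
  rw [h.isStarProjection.le_iff_mul_eq_left h'.isStarProjection,
    (h.indicator_mul h').indicator_eq_iff h, Set.inter_eq_left]

end IsDiagonal

end Diagonal

section DiagonalAlgebra

variable {A : Type*} {T P : ℓ²(A, ℂ) →L[ℂ] ℓ²(A, ℂ)} {t : A → ℂ} {c : Set A} {r s : Setoid A}

/-- The algebra of the bounded diagonal operators whose diagonal is constant on the classes
of `r`. -/
def diagonalAlgebra (r : Setoid A) : Set (ℓ²(A, ℂ) →L[ℂ] ℓ²(A, ℂ)) :=
  {T | ∃ t, IsDiagonal T t ∧ r ≤ Setoid.ker t}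

theorem IsDiagonal.mem_diagonalAlgebra_iff (h : IsDiagonal T t) :
    T ∈ diagonalAlgebra r ↔ r ≤ Setoid.ker t :=
  ⟨fun ⟨_, h', ht⟩ => h.unique h' ▸ ht, fun ht => ⟨t, h, ht⟩⟩

theorem IsDiagonal.indicator_mem_diagonalAlgebra_iff (h : IsDiagonal T (c.indicator 1)) :
    T ∈ diagonalAlgebra r ↔ ∀ a b, r a b → (a ∈ c ↔ b ∈ c) := by
  rw [h.mem_diagonalAlgebra_iff]
  refine forall₂_congr fun a b => forall_congr' fun _ => ?_
  rw [Setoid.ker_def]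
  by_cases ha : a ∈ c <;> by_cases hb : b ∈ c <;> simp [ha, hb]

theorem exists_indicator_of_mem_diagonalAlgebra (hP : P ∈ diagonalAlgebra r)
    (hproj : IsStarProjection P) : ∃ c : Set A, IsDiagonal P (c.indicator 1) := by
  obtain ⟨t, ht, -⟩ := hP
  exact ⟨_, ht.eq_indicator_of_isStarProjection hproj ▸ ht⟩

theorem mem_iff_mem_of_mem_classes (hc : c ∈ r.classes) {a b : A} (hab : r a b) :
    a ∈ c ↔ b ∈ c := by
  obtain ⟨a₀, rfl⟩ := hc
  exact ⟨r.trans (r.symm hab), r.trans hab⟩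

theorem IsDiagonal.isMinimalProjection_iff (h : IsDiagonal P (c.indicator 1)) :
    IsMinimalProjection (diagonalAlgebra r) P ↔ c ∈ r.classes := by
  constructor
  · rintro ⟨hmem, -, hne, hmin⟩
    have sat := h.indicator_mem_diagonalAlgebra_iff.mp hmem
    obtain ⟨a, ha⟩ := h.ne_zero_iff.mp hne
    have hcls : {b | r b a} ∈ r.classes := ⟨a, rfl⟩
    obtain ⟨Q, hQ⟩ := exists_isDiagonal_indicator {b | r b a}
    have hQP : Q = P := hmin Q
      (hQ.indicator_mem_diagonalAlgebra_iff.mpr fun _ _ => mem_iff_mem_of_mem_classes hcls)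
      hQ.isStarProjection (hQ.ne_zero_iff.mpr ⟨a, r.refl a⟩)
      ((hQ.le_iff h).mpr fun b hb => (sat b a hb).mpr ha)
    exact (hQ.indicator_eq_iff h).mp hQP ▸ hcls
  · rintro ⟨a, rfl⟩
    refine ⟨h.indicator_mem_diagonalAlgebra_iff.mpr fun _ _ =>
        mem_iff_mem_of_mem_classes ⟨a, rfl⟩, h.isStarProjection,
      h.ne_zero_iff.mpr ⟨a, r.refl a⟩, fun Q hQmem hQproj hQne hQle => ?_⟩
    obtain ⟨d, hd⟩ := exists_indicator_of_mem_diagonalAlgebra hQmem hQproj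
    have hda := (hd.le_iff h).mp hQle
    obtain ⟨b, hb⟩ := hd.ne_zero_iff.mp hQne
    refine (hd.indicator_eq_iff h).mpr (hda.antisymm fun b' hb' => ?_)
    exact (hd.indicator_mem_diagonalAlgebra_iff.mp hQmem b' b
      (r.trans hb' (r.symm (hda hb)))).mpr hb

theorem isMinimalProjection_diagonalAlgebra_iff :
    IsMinimalProjection (diagonalAlgebra r) P ↔
      ∃ c ∈ r.classes, IsDiagonal P (c.indicator 1) := by
  refine ⟨fun hP => ?_, fun ⟨c, hc, h⟩ => h.isMinimalProjection_iff.mpr hc⟩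
  obtain ⟨c, h⟩ := exists_indicator_of_mem_diagonalAlgebra hP.1 hP.2.1
  exact ⟨c, h.isMinimalProjection_iff.mp hP, h⟩

theorem diagonalAlgebra_subset_iff : diagonalAlgebra r ⊆ diagonalAlgebra s ↔ s ≤ r := by
  refine ⟨fun h a b hab => ?_, fun h T ⟨t, hT, ht⟩ => ⟨t, hT, h.trans ht⟩⟩
  obtain ⟨P, hP⟩ := exists_isDiagonal_indicator {x | r x b}
  have hmem : P ∈ diagonalAlgebra r := hP.indicator_mem_diagonalAlgebra_iff.mpr fun _ _ =>
    mem_iff_mem_of_mem_classes ⟨b, rfl⟩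
  exact (hP.indicator_mem_diagonalAlgebra_iff.mp (h hmem) a b hab).mpr (r.refl b)

theorem diagonalAlgebra_injective :
    Function.Injective (diagonalAlgebra : Setoid A → Set (ℓ²(A, ℂ) →L[ℂ] ℓ²(A, ℂ))) :=
  fun _ _ h => le_antisymm (diagonalAlgebra_subset_iff.mp h.ge) (diagonalAlgebra_subset_iff.mp h.le)

end DiagonalAlgebra

/-! ### Multiplication operators -/

section MultiplicationGraph

variable {A : Type*} {t : A → ℂ}

/-- The graph of the maximal, possibly unbounded, operator of multiplication by `t` on `ℓ²(A)`. -/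
def mulGraph (t : A → ℂ) : Submodule ℂ (ℓ²(A, ℂ) × ℓ²(A, ℂ)) where
  carrier := {p | ∀ a, p.2 a = t a * p.1 a}
  add_mem' hp hq a := by simp [hp a, hq a, mul_add]
  zero_mem' a := by simp
  smul_mem' z p hp a := by simp [hp a, mul_left_comm]

theorem mem_mulGraph {x y : ℓ²(A, ℂ)} : (x, y) ∈ mulGraph t ↔ ∀ a, y a = t a * x a := Iff.rfl

theorem continuous_coord (a : A) : Continuous fun x : ℓ²(A, ℂ) => x a :=
  (lp.evalCLM ℂ (fun _ : A => ℂ) 2 a).continuous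

theorem isClosed_mulGraph (t : A → ℂ) : IsClosed (mulGraph t : Set (ℓ²(A, ℂ) × ℓ²(A, ℂ))) := by
  have : (mulGraph t : Set (ℓ²(A, ℂ) × ℓ²(A, ℂ))) =
      ⋂ a, {p | p.2 a = t a * p.1 a} := by
    ext p
    rw [Set.mem_iInter]
    rfl
  rw [this]
  exact isClosed_iInter fun a => isClosed_eq ((continuous_coord a).comp continuous_snd)
    (((continuous_coord a).comp continuous_fst).const_mul _)

theorem mulGraph_le [DecidableEq A] {G : Submodule ℂ (ℓ²(A, ℂ) × ℓ²(A, ℂ))}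
    (hG : IsClosed (G : Set (ℓ²(A, ℂ) × ℓ²(A, ℂ))))
    (h : ∀ a, (lp.single 2 a 1, t a • lp.single 2 a 1) ∈ G) : mulGraph t ≤ G := by
  rintro ⟨x, y⟩ hxy
  have hx := lp.hasSum_single (p := 2) (by simp) x
  have hy := lp.hasSum_single (p := 2) (by simp) y
  refine hG.mem_of_tendsto (hx.prodMk hy) (.of_forall fun s => G.sum_mem fun a _ => ?_)
  have e : (lp.single 2 a (x a), lp.single 2 a (y a)) =
      x a • ((lp.single 2 a 1, t a • lp.single 2 a 1) : ℓ²(A, ℂ) × ℓ²(A, ℂ)) := by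
    simp [← lp.single_smul, mem_mulGraph.mp hxy a, mul_comm]
  exact e ▸ G.smul_mem _ (h a)

theorem mem_graphEigenspace_mulGraph {z : ℂ} {x : ℓ²(A, ℂ)} :
    x ∈ graphEigenspace (mulGraph t) z ↔ Function.support x ⊆ t ⁻¹' {z} := by
  refine forall_congr' fun a => ?_
  change z * x a = t a * x a ↔ (x a ≠ 0 → t a = z)
  rw [mul_eq_mul_right_iff, eq_comm (a := z), or_iff_not_imp_right]

theorem isDiagonal_starProjection {V : Submodule ℂ ℓ²(A, ℂ)} [V.HasOrthogonalProjection]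
    {c : Set A} (hV : ∀ x, x ∈ V ↔ Function.support x ⊆ c) :
    IsDiagonal V.starProjection (c.indicator 1) := by
  obtain ⟨P, hP⟩ := exists_isDiagonal_indicator c
  have key : ∀ x, P x = V.starProjection x := fun x => by
    refine (Submodule.eq_starProjection_of_mem_of_inner_eq_zero ((hV _).mpr fun a ha => ?_)
      fun w hw => ?_).symm
    · by_contra hac
      exact ha (by rw [hP]; simp [hac])
    · refine (lp.hasSum_inner _ _).unique (hasSum_zero.congr_fun fun a => ?_)
      by_cases hac : a ∈ c
      · simp [hP x a, hac]
      · simp [hP x a, hac, Function.notMem_support.mp fun h => hac ((hV w).mp hw h)]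
  exact fun x => key x ▸ hP x

theorem isResolventAt_of_isDiagonal {z : ℂ} (hz : ∀ a, t a ≠ z) {R : ℓ²(A, ℂ) →L[ℂ] ℓ²(A, ℂ)}
    (hR : IsDiagonal R fun a => (z - t a)⁻¹) : IsResolventAt (mulGraph t) z R := by
  have hne : ∀ a, z - t a ≠ 0 := fun a => sub_ne_zero.mpr (hz a).symm
  refine ⟨fun w a => ?_, fun x y hxy => lp.ext (funext fun a => ?_)⟩
  · have := hne a
    simp only [lp.coeFn_sub, lp.coeFn_smul, Pi.sub_apply, Pi.smul_apply, smul_eq_mul, hR w a]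
    field_simp
    ring
  · rw [hR]
    simp only [lp.coeFn_sub, lp.coeFn_smul, Pi.sub_apply, Pi.smul_apply, smul_eq_mul,
      mem_mulGraph.mp hxy a]
    rw [← sub_mul, inv_mul_cancel_left₀ (hne a)]

theorem one_le_norm_mul_of_isResolventAt {z : ℂ} {R : ℓ²(A, ℂ) →L[ℂ] ℓ²(A, ℂ)}
    (hR : IsResolventAt (mulGraph t) z R) (a : A) : 1 ≤ ‖R‖ * ‖z - t a‖ := by
  classical
  have hmem : ((lp.single 2 a 1, t a • lp.single 2 a 1) : ℓ²(A, ℂ) × ℓ²(A, ℂ)) ∈ mulGraph t :=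
    fun b => by rcases eq_or_ne b a with rfl | hb <;> simp [*]
  have hsingle := R.le_opNorm ((z - t a) • lp.single 2 a (1 : ℂ))
  rw [sub_smul, hR.2 _ _ hmem, ← sub_smul, norm_smul, lp.norm_single (by simp)] at hsingle
  simpa using hsingle

theorem graphSpectrum_mulGraph (t : A → ℂ) :
    graphSpectrum (mulGraph t) = closure (Set.range t) := by
  ext z
  rw [graphSpectrum, Set.mem_ofPred_eq, not_iff_comm, Metric.mem_closure_range_iff]
  push Not
  constructor
  · rintro ⟨δ, hδ, hgap⟩
    have bdd : Bornology.IsBounded (Set.range fun a => (z - t a)⁻¹) := by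
      refine isBounded_iff_forall_norm_le.mpr ⟨δ⁻¹, ?_⟩
      rintro _ ⟨a, rfl⟩
      rw [norm_inv, ← dist_eq_norm]
      exact inv_anti₀ hδ (hgap a)
    obtain ⟨R, hR⟩ := exists_isDiagonal bdd
    refine ⟨R, isResolventAt_of_isDiagonal (fun a ha => ?_) hR⟩
    exact hδ.not_ge (by simpa [ha] using hgap a)
  · rintro ⟨R, hR⟩
    refine ⟨(‖R‖ + 1)⁻¹, by positivity, fun a => ?_⟩
    rw [inv_le_iff_one_le_mul₀' (by positivity), dist_eq_norm]
    have := one_le_norm_mul_of_isResolventAt hR a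
    nlinarith [norm_nonneg (z - t a)]

end MultiplicationGraph

section FibreDecomposition

variable {A ι : Type*} {g : A → ι} {P : ι → ℓ²(A, ℂ) →L[ℂ] ℓ²(A, ℂ)}
  {T : ℓ²(A, ℂ) →L[ℂ] ℓ²(A, ℂ)}

theorem hasSum_fibre_apply (hP : ∀ i, IsDiagonal (P i) ((g ⁻¹' {i}).indicator 1))
    (x : ℓ²(A, ℂ)) : HasSum (fun i => P i x) x := by
  classical
  have hsum := (Equiv.sigmaFiberEquiv g).hasSum_iff.mpr (lp.hasSum_single (p := 2) (by simp) x)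
  refine hsum.sigma fun i => ?_
  have hfib := lp.hasSum_single (p := 2) (by simp) (P i x)
  have supp : Function.support (fun a => (lp.single 2 a (P i x a) : ℓ²(A, ℂ))) ⊆ {a | g a = i} :=
    fun a ha => by
      by_contra hai
      exact ha (by simp [hP i x a, show g a ≠ i from hai])
  refine ((hasSum_subtype_iff_of_support_subset supp).mpr hfib).congr_fun fun ⟨a, ha⟩ => ?_
  simp [hP i x a, show g a = i from ha]

theorem hasSum_smul_fibre_iff (hP : ∀ i, IsDiagonal (P i) ((g ⁻¹' {i}).indicator 1))
    (f : ι → ℂ) : (∀ x, HasSum (fun i => f i • P i x) (T x)) ↔ IsDiagonal T (f ∘ g) := by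
  constructor
  · intro h x a
    have coord := (h x).mapL (lp.evalCLM ℂ (fun _ : A => ℂ) 2 a)
    have other : ∀ i ≠ g a, f i * P i x a = 0 := fun i hi => by simp [hP i x a, hi.symm]
    have diag : f (g a) * P (g a) x a = (f ∘ g) a * x a := by simp [hP (g a) x a]
    exact (coord.unique (hasSum_single (g a) other)).trans diag
  · intro h x
    refine (hasSum_fibre_apply hP (T x)).congr_fun fun i => lp.ext (funext fun a => ?_)
    by_cases hi : g a = i <;> simp [hP i _ a, h x a, hi]

theorem mem_diagonalAlgebra_ker_iff [TopologicalSpace ι] [DiscreteTopology ι]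
    (hg : Function.Surjective g) (hP : ∀ i, IsDiagonal (P i) ((g ⁻¹' {i}).indicator 1)) :
    T ∈ diagonalAlgebra (Setoid.ker g) ↔
      ∃ f : BoundedContinuousFunction ι ℂ, ∀ x, HasSum (fun i => f i • P i x) (T x) := by
  simp only [hasSum_smul_fibre_iff hP]
  constructor
  · rintro ⟨t, hT, ht⟩
    have hf : t ∘ Function.surjInv hg ∘ g = t :=
      funext fun a => ht (Function.surjInv_eq hg (g a))
    refine ⟨.ofNormedAddCommGroupDiscrete (t ∘ Function.surjInv hg) ‖T‖
      fun i => hT.norm_apply_le _, ?_⟩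
    exact (show IsDiagonal T (t ∘ Function.surjInv hg ∘ g) from hf.symm ▸ hT)
  · rintro ⟨f, hf⟩
    exact ⟨_, hf, fun a b hab => congrArg f hab⟩

end FibreDecomposition

/-! ### Blocks of operators on the tensor power -/

section Push

variable {A B B' : Type*} {g : A → B} {g' : B' → B}

theorem pull_single_of_notMem_range [DecidableEq B] (hg : Function.Injective g) {b : B}
    (hb : b ∉ Set.range g) (z : ℂ) : pull g hg (lp.single 2 b z) = 0 :=
  lp.ext <| funext fun a => by
    have : g a ≠ b := fun h => hb ⟨a, h⟩
    simp [this]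

theorem pull_single [DecidableEq A] [DecidableEq B] (hg : Function.Injective g) (a : A) (z : ℂ) :
    pull g hg (lp.single 2 (g a) z) = lp.single 2 a z :=
  lp.ext <| funext fun a' => by rcases eq_or_ne a' a with rfl | h <;> simp [*, hg.ne_iff]

/-- The adjoint of `pull`: the isometry of `ℓ²(A)` into `ℓ²(B)` that carries the basis vector at `a`
to the one at `g a`. -/
def push (g : A → B) (hg : Function.Injective g) : ℓ²(A, ℂ) →L[ℂ] ℓ²(B, ℂ) :=
  ContinuousLinearMap.adjoint (pull g hg)

theorem inner_push (hg : Function.Injective g) (x : ℓ²(A, ℂ)) (y : ℓ²(B, ℂ)) :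
    ⟪y, push g hg x⟫_ℂ = ⟪pull g hg y, x⟫_ℂ :=
  ContinuousLinearMap.adjoint_inner_right _ _ _

theorem push_apply (hg : Function.Injective g) (x : ℓ²(A, ℂ)) (a : A) :
    push g hg x (g a) = x a := by
  classical
  have := inner_push hg x (lp.single 2 (g a) 1)
  rw [pull_single, lp.inner_single_left, lp.inner_single_left] at this
  simpa using this

theorem push_apply_of_notMem_range (hg : Function.Injective g) (x : ℓ²(A, ℂ)) {b : B}
    (hb : b ∉ Set.range g) : push g hg x b = 0 := by
  classical
  have := inner_push hg x (lp.single 2 b 1)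
  rw [pull_single_of_notMem_range hg hb, lp.inner_single_left, inner_zero_left] at this
  simpa using this

theorem push_single [DecidableEq A] [DecidableEq B] (hg : Function.Injective g) (a : A) (z : ℂ) :
    push g hg (lp.single 2 a z) = lp.single 2 (g a) z := by
  refine lp.ext <| funext fun b => ?_
  by_cases hb : b ∈ Set.range g
  · obtain ⟨a', rfl⟩ := hb
    rw [push_apply]
    rcases eq_or_ne a' a with rfl | h <;> simp [*, hg.ne_iff]
  · rw [push_apply_of_notMem_range hg _ hb, lp.single_apply_ne]
    rintro rfl
    exact hb ⟨a, rfl⟩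

theorem pull_push (hg : Function.Injective g) (x : ℓ²(A, ℂ)) : pull g hg (push g hg x) = x :=
  lp.ext <| funext fun a => push_apply hg x a

theorem pull_push_of_disjoint (hg : Function.Injective g) (hg' : Function.Injective g')
    (h : Disjoint (Set.range g') (Set.range g)) (x : ℓ²(A, ℂ)) : pull g' hg' (push g hg x) = 0 :=
  lp.ext <| funext fun b =>
    push_apply_of_notMem_range hg x (Set.disjoint_left.mp h ⟨b, rfl⟩)

end Push

section InsertPair

variable {J : Type*} {N : ℕ} {i j : Fin N}

theorem insertPair_self (α : Fin N → J) : insertPair i j α ![α i, α j] = α := by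
  simp [insertPair]

theorem insertPair_apply_of_ne {k : Fin N} (hi : k ≠ i) (hj : k ≠ j) (α : Fin N → J)
    (β : Fin 2 → J) : insertPair i j α β k = α k := by
  simp [insertPair, hi, hj]

theorem insertPair_apply_pair (hij : i ≠ j) (α : Fin N → J) (β : Fin 2 → J) :
    ![insertPair i j α β i, insertPair i j α β j] = β := by
  funext k
  fin_cases k <;> simp [insertPair, hij]

theorem insertPair_eq_iff {α γ : Fin N → J} :
    insertPair i j α = insertPair i j γ ↔ ∀ k, k ≠ i → k ≠ j → α k = γ k := by
  refine ⟨fun h k hi hj => ?_, fun h => funext₂ fun β k => ?_⟩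
  · rw [← insertPair_apply_of_ne hi hj α ![α i, α j], h, insertPair_apply_of_ne hi hj]
  · by_cases hj : k = j
    · simp [insertPair, hj]
    · by_cases hi : k = i
      · subst hi
        simp [insertPair, hj]
      · rw [insertPair_apply_of_ne hi hj, insertPair_apply_of_ne hi hj, h k hi hj]

theorem insertPair_insertPair (α : Fin N → J) (β : Fin 2 → J) :
    insertPair i j (insertPair i j α β) = insertPair i j α :=
  insertPair_eq_iff.mpr fun _ hi hj => insertPair_apply_of_ne hi hj α β

theorem insertPair_eq_or_disjoint_range (i j : Fin N) (α γ : Fin N → J) :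
    insertPair i j α = insertPair i j γ ∨
      Disjoint (Set.range (insertPair i j α)) (Set.range (insertPair i j γ)) := by
  refine or_iff_not_imp_right.mpr fun h => ?_
  obtain ⟨_, ⟨β, rfl⟩, β', h⟩ := Set.not_disjoint_iff.mp h
  rw [← insertPair_insertPair α β, ← h, insertPair_insertPair]

end InsertPair

section Compress

variable {J : Type*} {N : ℕ} {i j : Fin N} (hij : i ≠ j)
  {T : TensorPower J N →L[ℂ] TensorPower J N}

theorem pull_pairOp (B : TensorPower J 2 →L[ℂ] TensorPower J 2) (α : Fin N → J)
    (x : TensorPower J N) :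
    pull (insertPair i j α) (insertPair_injective hij α) (pairOp i j hij B x) =
      B (pull (insertPair i j α) (insertPair_injective hij α) x) := by
  refine lp.ext (funext fun β => ?_)
  rw [pull_apply, pairOp_apply, insertPair_apply_pair hij]
  simp only [insertPair_insertPair]

theorem pull_push_insertPair_comm (B : TensorPower J 2 →L[ℂ] TensorPower J 2) (α γ : Fin N → J)
    (x : TensorPower J 2) :
    pull (insertPair i j α) (insertPair_injective hij α)
        (push (insertPair i j γ) (insertPair_injective hij γ) (B x)) =
      B (pull (insertPair i j α) (insertPair_injective hij α)
        (push (insertPair i j γ) (insertPair_injective hij γ) x)) := by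
  obtain h | h := insertPair_eq_or_disjoint_range i j α γ
  · simp only [h, pull_push]
  · simp only [pull_push_of_disjoint _ _ h, map_zero]

theorem pairOp_push (B : TensorPower J 2 →L[ℂ] TensorPower J 2) (γ : Fin N → J)
    (x : TensorPower J 2) :
    pairOp i j hij B (push (insertPair i j γ) (insertPair_injective hij γ) x) =
      push (insertPair i j γ) (insertPair_injective hij γ) (B x) := by
  refine lp.ext (funext fun α => ?_)
  rw [pairOp_apply, ← pull_push_insertPair_comm hij, pull_apply, insertPair_self]

/-- The block of an operator on `N` factors in which the indices other than the `i`-th and the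
`j`-th are fixed, to those of `α` in the range and to those of `γ` in the domain. -/
def compress (T : TensorPower J N →L[ℂ] TensorPower J N) (α γ : Fin N → J) :
    TensorPower J 2 →L[ℂ] TensorPower J 2 :=
  pull (insertPair i j α) (insertPair_injective hij α) ∘L T ∘L
    push (insertPair i j γ) (insertPair_injective hij γ)

theorem compress_apply (T : TensorPower J N →L[ℂ] TensorPower J N) (α γ : Fin N → J)
    (x : TensorPower J 2) (β : Fin 2 → J) :
    compress hij T α γ x β =
      T (push (insertPair i j γ) (insertPair_injective hij γ) x) (insertPair i j α β) := rfl

theorem compress_pairOp_mul (B : TensorPower J 2 →L[ℂ] TensorPower J 2)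
    (T : TensorPower J N →L[ℂ] TensorPower J N) (α γ : Fin N → J) :
    compress hij (pairOp i j hij B * T) α γ = B * compress hij T α γ :=
  ContinuousLinearMap.ext fun _ => pull_pairOp hij B α _

theorem compress_mul_pairOp (T : TensorPower J N →L[ℂ] TensorPower J N)
    (B : TensorPower J 2 →L[ℂ] TensorPower J 2) (α γ : Fin N → J) :
    compress hij (T * pairOp i j hij B) α γ = compress hij T α γ * B :=
  ContinuousLinearMap.ext fun x => congrArg
    (fun y => pull (insertPair i j α) (insertPair_injective hij α) (T y)) (pairOp_push hij B γ x)

theorem compress_apply_single [DecidableEq J] (T : TensorPower J N →L[ℂ] TensorPower J N)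
    (α γ : Fin N → J) (β β' : Fin 2 → J) :
    compress hij T α γ (lp.single 2 β' 1) β =
      T (lp.single 2 (insertPair i j γ β') 1) (insertPair i j α β) := by
  rw [compress_apply, push_single]

theorem compress_injective : Function.Injective
    (compress (J := J) hij) := by
  classical
  intro T T' h
  refine ext_single fun γ => lp.ext <| funext fun α => ?_
  have := congrArg (fun S : TensorPower J 2 →L[ℂ] TensorPower J 2 =>
    S (lp.single 2 ![γ i, γ j] 1) ![α i, α j]) (congrFun₂ h α γ)
  simpa only [compress_apply_single, insertPair_self] using this

theorem commute_pairOp_iff {B : TensorPower J 2 →L[ℂ] TensorPower J 2} :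
    pairOp i j hij B * T = T * pairOp i j hij B ↔
      ∀ α γ, B * compress hij T α γ = compress hij T α γ * B := by
  simp only [← compress_pairOp_mul, ← compress_mul_pairOp]
  exact ⟨fun h α γ => h ▸ rfl, fun h => compress_injective hij (funext₂ h)⟩

theorem IsDiagonal.compress {t : (Fin N → J) → ℂ} (hT : IsDiagonal T t) (α : Fin N → J) :
    IsDiagonal (compress hij T α α) (t ∘ insertPair i j α) := fun x β => by
  rw [compress_apply, hT, push_apply, Function.comp_apply]

theorem IsDiagonal.compress_of_disjoint {t : (Fin N → J) → ℂ} (hT : IsDiagonal T t)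
    {α γ : Fin N → J}
    (h : Disjoint (Set.range (insertPair i j α)) (Set.range (insertPair i j γ))) :
    QuantumKac.compress hij T α γ = 0 :=
  ContinuousLinearMap.ext fun x => lp.ext <| funext fun β => by
    rw [compress_apply, hT, push_apply_of_notMem_range _ x (Set.disjoint_left.mp h ⟨β, rfl⟩),
      mul_zero]
    rfl

/-- The commutant of the operators of `𝒰` acting on all pairs of factors of the `N`-fold tensor
power. -/
def pairCommutant (𝒰 : Set (TensorPower J 2 →L[ℂ] TensorPower J 2)) (N : ℕ) :
    Set (TensorPower J N →L[ℂ] TensorPower J N) :=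
  Set.centralizer {T | ∃ (i j : Fin N) (hij : i < j), ∃ B ∈ 𝒰, T = pairOp i j hij.ne B}

theorem mem_pairCommutant_iff {𝒰 : Set (TensorPower J 2 →L[ℂ] TensorPower J 2)} :
    T ∈ pairCommutant 𝒰 N ↔
      ∀ (i j : Fin N) (hij : i < j) α γ, compress hij.ne T α γ ∈ Set.centralizer 𝒰 := by
  simp only [pairCommutant, Set.mem_centralizer_iff]
  constructor
  · exact fun h i j hij α γ B hB =>
      (commute_pairOp_iff hij.ne).mp (h _ ⟨i, j, hij, B, hB, rfl⟩) α γ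
  · rintro h _ ⟨i, j, hij, B, hB, rfl⟩
    exact (commute_pairOp_iff hij.ne).mpr fun α γ => h i j hij α γ B hB

end Compress

theorem CollisionSpecification.commutant_eq_pairCommutant {H : Type*} [NormedAddCommGroup H]
    [InnerProductSpace ℂ H] [CompleteSpace H] {J : Type*} [LinearOrder J]
    [LocallyFiniteOrderBot J] {S : SingleParticle H J} {C : Type*} [MetricSpace C] [CompactSpace C]
    [MeasurableSpace C] [BorelSpace C] (K : CollisionSpecification S C) (N : ℕ) :
    K.commutant N =
      pairCommutant (Set.range fun σ => (K.U σ : TensorPower J 2 →L[ℂ] TensorPower J 2)) N := by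
  simp only [commutant, pairCommutant, Set.exists_range_iff]

/-! ### The Hamiltonian in its eigenbasis -/

section CofiniteCocompact

open Filter

variable {X Y : Type*} [TopologicalSpace Y] [T2Space Y] [WeaklyLocallyCompactSpace Y] {f : X → Y}

theorem isClosed_range_of_tendsto_cofinite_cocompact (hf : Tendsto f cofinite (cocompact Y)) :
    IsClosed (Set.range f) := by
  let : TopologicalSpace X := ⊥
  have : DiscreteTopology X := ⟨rfl⟩
  have proper : IsProperMap f := isProperMap_iff_tendsto_cocompact.mpr
    ⟨continuous_of_discreteTopology, by rwa [cocompact_eq_cofinite]⟩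
  exact proper.isClosedMap.isClosed_range

theorem discreteTopology_range_of_tendsto_cofinite_cocompact
    (hf : Tendsto f cofinite (cocompact Y)) : DiscreteTopology (Set.range f) := by
  refine continuous_subtype_val.discrete_of_tendsto_cofinite_cocompact
    (tendsto_cofinite_cocompact_iff.mpr fun K hK => ?_)
  refine ((tendsto_cofinite_cocompact_iff.mp hf K hK).image (Set.rangeFactorization f)).subset ?_
  rintro ⟨_, a, rfl⟩ ha
  exact ⟨a, ha, rfl⟩

end CofiniteCocompact

theorem finite_le_norm_eigenvalue {𝕜 H J : Type*} [RCLike 𝕜] [NormedAddCommGroup H]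
    [InnerProductSpace 𝕜 H] {R : H →L[𝕜] H} (hR : IsCompactOperator R) {v : J → H}
    (hv : Orthonormal 𝕜 v) {μ : J → 𝕜} (hμ : ∀ j, R (v j) = μ j • v j) {ε : ℝ} (hε : 0 < ε) :
    {j | ε ≤ ‖μ j‖}.Finite := by
  classical
  let : TopologicalSpace {j | ε ≤ ‖μ j‖} := ⊥
  have : DiscreteTopology {j | ε ≤ ‖μ j‖} := ⟨rfl⟩
  have sep : Pairwise fun j k : {j | ε ≤ ‖μ j‖} => ε ≤ dist (R (v j)) (R (v k)) := by
    intro j k hjk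
    have coord : inner 𝕜 (v j) (R (v j) - R (v k)) = μ j := by
      rw [inner_sub_right, hμ, hμ, inner_smul_right, inner_smul_right,
        orthonormal_iff_ite.mp hv, orthonormal_iff_ite.mp hv]
      simp [Subtype.coe_injective.ne hjk]
    have cs := norm_inner_le_norm (𝕜 := 𝕜) (v j) (R (v j) - R (v k))
    rw [coord, hv.norm_eq_one, one_mul, ← dist_eq_norm] at cs
    exact le_trans j.2 cs
  obtain ⟨Q, hQ, hRQ⟩ := hR.image_closedBall_subset_compact 1
  have compact := (Metric.isClosedEmbedding_of_pairwise_le_dist hε sep).isCompact_preimage hQ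
  have univ : (fun j : {j | ε ≤ ‖μ j‖} => R (v j)) ⁻¹' Q = Set.univ :=
    Set.eq_univ_of_forall fun j => hRQ ⟨v j, by simp [hv.norm_eq_one], rfl⟩
  rw [univ, isCompact_iff_finite, Set.finite_univ_iff] at compact
  exact compact

namespace SingleParticle

variable {H : Type*} [NormedAddCommGroup H] [InnerProductSpace ℂ H] [CompleteSpace H]
  {J : Type*} [LinearOrder J] [LocallyFiniteOrderBot J] (S : SingleParticle H J) {N : ℕ}

section Energy

theorem resolvent_apply_ψ {z : ℂ} {R : H →L[ℂ] H} (hR : IsResolventAt S.h.graph z R) (j : J) :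
    z - S.e j ≠ 0 ∧ R (S.ψ j) = (z - S.e j)⁻¹ • S.ψ j := by
  have inv : (z - S.e j) • R (S.ψ j) = S.ψ j := by
    rw [← map_smul, sub_smul]
    exact hR.2 _ _ (S.eigen j)
  have hz : z - S.e j ≠ 0 := fun h =>
    S.ψ.orthonormal.ne_zero j (by rw [← inv, h, zero_smul])
  exact ⟨hz, (eq_inv_smul_iff₀ hz).mpr inv⟩

theorem bddBelow_e : ∃ m, ∀ j, m ≤ S.e j := by
  rcases isEmpty_or_nonempty J with hJ | ⟨⟨a⟩⟩
  · exact ⟨0, fun j => hJ.elim j⟩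
  · obtain ⟨b, -, hb⟩ := (Finset.Iic a).exists_min_image S.e ⟨a, by simp⟩
    refine ⟨S.e b, fun j => ?_⟩
    rcases le_total j a with h | h
    · exact hb j (by simpa using h)
    · exact (hb a (by simp)).trans (S.monotone_e h)

theorem finite_e_le (c : ℝ) : {j | S.e j ≤ c}.Finite := by
  obtain ⟨m, hm⟩ := S.bddBelow_e
  obtain ⟨z, R, hR, compact⟩ := S.compactResolvent
  refine (finite_le_norm_eigenvalue compact S.ψ.orthonormal
    (fun j => (S.resolvent_apply_ψ hR j).2)
    (ε := (‖z‖ + max |m| |c| + 1)⁻¹) (by positivity)).subset fun j (hj : S.e j ≤ c) => ?_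
  have habs : ‖(S.e j : ℂ)‖ ≤ max |m| |c| := by
    rw [Complex.norm_real]
    exact abs_le_max_abs_abs (hm j) hj
  rw [Set.mem_ofPred_eq, norm_inv]
  refine inv_anti₀ (norm_pos_iff.mpr (S.resolvent_apply_ψ hR j).1) ?_
  linarith [norm_sub_le z (S.e j)]

theorem finite_energy_le (N : ℕ) (c : ℝ) : {α : Fin N → J | S.energy α ≤ c}.Finite := by
  obtain ⟨m, hm⟩ := S.bddBelow_e
  refine (Set.Finite.pi' fun _ : Fin N => S.finite_e_le (c - N * m + m)).subset
    fun α (hα : S.energy α ≤ c) i => ?_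
  have single_le := Finset.single_le_sum (f := fun i => S.e (α i) - m)
    (fun i _ => sub_nonneg.mpr (hm _)) (Finset.mem_univ i)
  have sum_eq : ∑ i, (S.e (α i) - m) = S.energy α - N * m := by simp [energy]
  rw [Set.mem_ofPred_eq]
  linarith

theorem tendsto_energy_cofinite_cocompact (N : ℕ) :
    Filter.Tendsto (fun α : Fin N → J => (S.energy α : ℂ)) Filter.cofinite
      (Filter.cocompact ℂ) := by
  refine tendsto_cofinite_cocompact_iff.mpr fun Q hQ => ?_
  obtain ⟨c, hc⟩ := isBounded_iff_forall_norm_le.mp hQ.isBounded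
  refine (S.finite_energy_le N c).subset fun α hα => ?_
  exact (Real.le_norm_self _).trans (Complex.norm_real (S.energy α) ▸ hc _ hα)

end Energy

section Hamiltonian

theorem Ψ_eq_single (α : Fin N → J) : S.Ψ α = lp.single 2 α 1 := by
  refine lp.ext (funext fun β => ?_)
  simp only [Ψ, tprod_apply, orthonormal_iff_ite.mp S.ψ.orthonormal, Finset.prod_ite_zero,
    lp.single_apply, Pi.single_apply, funext_iff]
  simp

theorem inner_ψ_h (j : J) (φ : S.h.domain) :
    ⟪S.ψ j, S.h φ⟫_ℂ = (S.e j : ℂ) * ⟪S.ψ j, (φ : H)⟫_ℂ := by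
  have symmetric : S.h.IsFormalAdjoint S.h := by
    have := LinearPMap.adjoint_isFormalAdjoint S.selfAdjoint.dense_domain
    rwa [LinearPMap.isSelfAdjoint_def.mp S.selfAdjoint] at this
  obtain ⟨y, hy, hhy⟩ := (LinearPMap.mem_graph_iff _).mp (S.eigen j)
  dsimp only at hy hhy
  rw [← hy, ← symmetric y φ, hhy, inner_smul_left, Complex.conj_ofReal, hy]

theorem sum_tprod_update_apply (φ : Fin N → S.h.domain) (β : Fin N → J) :
    (∑ j, tprod S.ψ (Function.update (fun i => (φ i : H)) j (S.h (φ j))) : TensorPower J N) β =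
      (S.energy β : ℂ) * tprod S.ψ (fun i => (φ i : H)) β := by
  rw [lp.coeFn_sum, Finset.sum_apply]
  simp only [tprod_apply, energy, Complex.ofReal_sum, Finset.sum_mul]
  refine Finset.sum_congr rfl fun j _ => ?_
  rw [← Finset.mul_prod_erase _ _ (Finset.mem_univ j),
    ← Finset.mul_prod_erase _ (fun i => ⟪S.ψ (β i), (φ i : H)⟫_ℂ) (Finset.mem_univ j),
    Function.update_self, inner_ψ_h, mul_assoc]
  congr 2
  refine Finset.prod_congr rfl fun k hk => ?_
  rw [Function.update_of_ne (Finset.ne_of_mem_erase hk)]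

theorem Ψ_mem_hamiltonian (α : Fin N → J) :
    (S.Ψ α, (S.energy α : ℂ) • S.Ψ α) ∈ S.hamiltonian N := by
  let φ : Fin N → S.h.domain := fun i =>
    ⟨S.ψ (α i), LinearPMap.mem_domain_of_mem_graph (S.eigen (α i))⟩
  refine Submodule.le_topologicalClosure _ (Submodule.subset_span
    ⟨φ, Prod.ext rfl (lp.ext (funext fun β => ?_))⟩)
  refine Eq.trans ?_ (S.sum_tprod_update_apply φ β).symm
  change (S.energy α : ℂ) * S.Ψ α β = (S.energy β : ℂ) * S.Ψ α β
  rcases eq_or_ne β α with rfl | hβ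
  · rfl
  · simp [Ψ_eq_single, hβ]

theorem hamiltonian_eq_mulGraph (N : ℕ) :
    S.hamiltonian N = mulGraph fun α : Fin N → J => (S.energy α : ℂ) := by
  refine le_antisymm (Submodule.topologicalClosure_minimal _ (Submodule.span_le.mpr ?_)
    (isClosed_mulGraph _)) (mulGraph_le (Submodule.isClosed_topologicalClosure _) fun α => ?_)
  · rintro _ ⟨φ, rfl⟩
    exact S.sum_tprod_update_apply φ
  · exact S.Ψ_eq_single α ▸ S.Ψ_mem_hamiltonian α

theorem Ψ_mem_hamiltonian_iff {α : Fin N → J} {E : ℂ} :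
    (S.Ψ α, E • S.Ψ α) ∈ S.hamiltonian N ↔ (S.energy α : ℂ) = E := by
  refine ⟨fun h => ?_, fun h => h ▸ S.Ψ_mem_hamiltonian α⟩
  rw [hamiltonian_eq_mulGraph, Ψ_eq_single] at h
  simpa using (mem_mulGraph.mp h α).symm

theorem spec_eq_range (N : ℕ) :
    S.spec N = Set.range fun α : Fin N → J => (S.energy α : ℂ) := by
  rw [spec, hamiltonian_eq_mulGraph, graphSpectrum_mulGraph,
    (isClosed_range_of_tendsto_cofinite_cocompact
      (S.tendsto_energy_cofinite_cocompact N)).closure_eq]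

theorem energy_mem_spec (α : Fin N → J) : (S.energy α : ℂ) ∈ S.spec N :=
  S.spec_eq_range N ▸ ⟨α, rfl⟩

theorem discreteTopology_spec (N : ℕ) : DiscreteTopology (S.spec N) :=
  S.spec_eq_range N ▸ discreteTopology_range_of_tendsto_cofinite_cocompact
    (S.tendsto_energy_cofinite_cocompact N)

theorem isDiagonal_energyProj (N : ℕ) (E : ℂ) :
    IsDiagonal (S.energyProj N E) ({α | (S.energy α : ℂ) = E}.indicator 1) :=
  isDiagonal_starProjection fun x => by
    rw [energyShell, hamiltonian_eq_mulGraph]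
    exact mem_graphEigenspace_mulGraph

theorem energyAlgebra_eq_diagonalAlgebra (N : ℕ) :
    S.energyAlgebra N = diagonalAlgebra (Setoid.ker (S.energy : (Fin N → J) → ℝ)) := by
  have := S.discreteTopology_spec N
  let en (α : Fin N → J) : S.spec N := ⟨S.energy α, S.energy_mem_spec α⟩
  have en_eq_iff {α : Fin N → J} {E : S.spec N} : en α = E ↔ (S.energy α : ℂ) = E :=
    Subtype.ext_iff
  have surj : Function.Surjective en := fun E => by
    obtain ⟨α, hα⟩ := (S.spec_eq_range N).le E.2
    exact ⟨α, en_eq_iff.mpr hα⟩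
  have ker_en : Setoid.ker en = Setoid.ker (S.energy : (Fin N → J) → ℝ) :=
    Setoid.ext fun α α' => en_eq_iff.trans Complex.ofReal_inj
  have fibre (E : S.spec N) : IsDiagonal (S.energyProj N E) ((en ⁻¹' {E}).indicator 1) := by
    simpa only [Set.preimage, Set.mem_singleton_iff, en_eq_iff] using S.isDiagonal_energyProj N E
  rw [← ker_en]
  exact Set.ext fun T => (mem_diagonalAlgebra_ker_iff surj fibre).symm

end Hamiltonian

end SingleParticle

/-! ### The commutant of the collisions -/

section CompressDiagonal

variable {J : Type*} {N : ℕ} {T : TensorPower J N →L[ℂ] TensorPower J N}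

theorem exists_lt_ne_of_ne (hN : 2 ≤ N) {α γ : Fin N → J} (h : α ≠ γ) :
    ∃ i j : Fin N, i < j ∧ ![α i, α j] ≠ ![γ i, γ j] := by
  obtain ⟨k, hk⟩ := Function.ne_iff.mp h
  have : Nontrivial (Fin N) := Fin.nontrivial_iff_two_le.mpr hN
  obtain ⟨l, hl⟩ := exists_ne k
  rcases lt_or_gt_of_ne hl with hlk | hkl
  · exact ⟨l, k, hlk, fun e => hk (congrFun e 1)⟩
  · exact ⟨k, l, hkl, fun e => hk (congrFun e 0)⟩

theorem exists_isDiagonal_of_compress (hN : 2 ≤ N)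
    (h : ∀ (i j : Fin N) (hij : i < j) α γ, ∃ t, IsDiagonal (compress hij.ne T α γ) t) :
    ∃ t, IsDiagonal T t := by
  classical
  refine ⟨_, isDiagonal_of_forall_ne fun α γ hαγ => ?_⟩
  obtain ⟨i, j, hij, hne⟩ := exists_lt_ne_of_ne hN hαγ
  obtain ⟨t, ht⟩ := h i j hij α γ
  have entry := compress_apply_single hij.ne T α γ ![α i, α j] ![γ i, γ j]
  rw [insertPair_self, insertPair_self, ht.apply_single, lp.single_apply_ne _ _ _ hne] at entry
  exact entry.symm

end CompressDiagonal

theorem forall_preimage_mem_classes_iff {A B : Type*} {r : Setoid A} {f : A → B}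
    (hr : r ≤ Setoid.ker f) :
    (∀ a, {x | f x = f a} ∈ r.classes) ↔ Setoid.ker f ≤ r := by
  refine ⟨fun h a b hab => ?_, fun h a => ⟨a, Set.ext fun x => ⟨fun hx => h hx, fun hx => hr hx⟩⟩⟩
  obtain ⟨c, hc⟩ := h b
  have key (x : A) : f x = f b ↔ r x c := Set.ext_iff.mp hc x
  exact r.trans ((key a).mp hab) (r.symm ((key b).mp rfl))

namespace SingleParticle

variable {H : Type*} [NormedAddCommGroup H] [InnerProductSpace ℂ H] [CompleteSpace H]
  {J : Type*} [LinearOrder J] [LocallyFiniteOrderBot J] (S : SingleParticle H J) {N : ℕ}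

section Adjacency

theorem adjacent_iff {α α' : Fin N → J} :
    S.Adjacent α α' ↔ ∃ i j : Fin N, i < j ∧ S.energy ![α i, α j] = S.energy ![α' i, α' j] ∧
      insertPair i j α = insertPair i j α' := by
  simp only [Adjacent, insertPair_eq_iff, energy, Fin.sum_univ_two, Matrix.cons_val_zero,
    Matrix.cons_val_one]

theorem adjacent_insertPair {i j : Fin N} (hij : i < j) (α : Fin N → J) {β β' : Fin 2 → J}
    (h : S.energy β = S.energy β') : S.Adjacent (insertPair i j α β) (insertPair i j α β') := by
  refine S.adjacent_iff.mpr ⟨i, j, hij, ?_, ?_⟩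
  · rwa [insertPair_apply_pair hij.ne, insertPair_apply_pair hij.ne]
  · rw [insertPair_insertPair, insertPair_insertPair]

theorem energy_insertPair {i j : Fin N} (hij : i ≠ j) (α : Fin N → J) (β : Fin 2 → J) :
    S.energy (insertPair i j α β) =
      S.energy β + ∑ k ∈ (Finset.univ.erase i).erase j, S.e (α k) := by
  have rest : ∑ k ∈ (Finset.univ.erase i).erase j, S.e (insertPair i j α β k) =
      ∑ k ∈ (Finset.univ.erase i).erase j, S.e (α k) := by
    refine Finset.sum_congr rfl fun k hk => ?_
    obtain ⟨hkj, hki, -⟩ := by simpa only [Finset.mem_erase] using hk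
    rw [insertPair_apply_of_ne hki hkj]
  rw [energy, ← Finset.add_sum_erase _ _ (Finset.mem_univ i), ← Finset.add_sum_erase _ _
    (Finset.mem_erase.mpr ⟨hij.symm, Finset.mem_univ j⟩), rest, ← add_assoc]
  simp [energy, insertPair, hij]

theorem indexSetoid_le_iff {r : Setoid (Fin N → J)} :
    S.indexSetoid N ≤ r ↔ ∀ α α', S.Adjacent α α' → r α α' := by
  refine ⟨fun h α α' adj => h (Relation.ReflTransGen.single adj), fun h α α' chain => ?_⟩
  induction (chain : Relation.ReflTransGen S.Adjacent α α') with
  | refl => exact r.refl α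
  | tail _ adj ih => exact r.trans ih (h _ _ adj)

theorem indexSetoid_le_ker_energy (N : ℕ) :
    S.indexSetoid N ≤ Setoid.ker (S.energy : (Fin N → J) → ℝ) := by
  refine S.indexSetoid_le_iff.mpr fun α α' adj => ?_
  obtain ⟨i, j, hij, he, hrest⟩ := S.adjacent_iff.mp adj
  rw [Setoid.ker_def, ← insertPair_self (i := i) (j := j) α,
    ← insertPair_self (i := i) (j := j) α', ← hrest, S.energy_insertPair hij.ne,
    S.energy_insertPair hij.ne, he]

theorem finite_of_mem_classes_indexSetoid {c : Set (Fin N → J)}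
    (hc : c ∈ (S.indexSetoid N).classes) : c.Finite := by
  obtain ⟨α₀, rfl⟩ := hc
  exact (S.finite_energy_le N (S.energy α₀)).subset fun _ hα =>
    (S.indexSetoid_le_ker_energy N hα).le

end Adjacency

section Commutant

variable {T : TensorPower J N →L[ℂ] TensorPower J N}

theorem compress_mem_diagonalAlgebra (hT : T ∈ diagonalAlgebra (S.indexSetoid N)) {i j : Fin N}
    (hij : i < j) (α γ : Fin N → J) :
    compress hij.ne T α γ ∈ diagonalAlgebra (Setoid.ker (S.energy : (Fin 2 → J) → ℝ)) := by
  obtain ⟨t, hT, ht⟩ := hT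
  obtain h | h := insertPair_eq_or_disjoint_range i j α γ
  · have eq : compress hij.ne T α γ = compress hij.ne T α α := by simp only [compress, h]
    rw [eq, (hT.compress hij.ne α).mem_diagonalAlgebra_iff]
    exact fun β β' hβ => S.indexSetoid_le_iff.mp ht _ _ (S.adjacent_insertPair hij α hβ)
  · rw [hT.compress_of_disjoint hij.ne h]
    exact ⟨0, fun x β => by simp, fun _ _ _ => rfl⟩

theorem mem_diagonalAlgebra_indexSetoid_iff (hN : 2 ≤ N) :
    T ∈ diagonalAlgebra (S.indexSetoid N) ↔ ∀ (i j : Fin N) (hij : i < j) α γ,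
      compress hij.ne T α γ ∈ diagonalAlgebra (Setoid.ker (S.energy : (Fin 2 → J) → ℝ)) := by
  refine ⟨fun hT _ _ hij => S.compress_mem_diagonalAlgebra hT hij, fun h => ?_⟩
  obtain ⟨t, hT⟩ := exists_isDiagonal_of_compress hN fun i j hij α γ =>
    (h i j hij α γ).imp fun _ => And.left
  refine hT.mem_diagonalAlgebra_iff.mpr (S.indexSetoid_le_iff.mpr fun α α' adj => ?_)
  obtain ⟨i, j, hij, he, hrest⟩ := S.adjacent_iff.mp adj
  have block := (hT.compress hij.ne α).mem_diagonalAlgebra_iff.mp (h i j hij α α) he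
  rwa [Setoid.ker_def, Function.comp_apply, Function.comp_apply, insertPair_self, hrest,
    insertPair_self] at block

theorem pairCommutant_eq_diagonalAlgebra {𝒰 : Set (TensorPower J 2 →L[ℂ] TensorPower J 2)}
    (h𝒰 : Set.centralizer 𝒰 = S.energyAlgebra 2) (hN : 2 ≤ N) :
    pairCommutant 𝒰 N = diagonalAlgebra (S.indexSetoid N) := by
  ext T
  rw [mem_pairCommutant_iff, h𝒰, energyAlgebra_eq_diagonalAlgebra,
    S.mem_diagonalAlgebra_indexSetoid_iff hN]

end Commutant

section Projections

variable {P : TensorPower J N →L[ℂ] TensorPower J N} {c : Set (Fin N → J)} {α₀ : Fin N → J}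

theorem isDiagonal_indexProj (hc : c.Finite) : IsDiagonal (S.indexProj c) (c.indicator 1) := by
  intro x β
  have term (α : Fin N → J) : InnerProductSpace.rankOne ℂ (S.Ψ α) (S.Ψ α) x β =
      if α = β then x α else 0 := by
    rw [InnerProductSpace.rankOne_apply, Ψ_eq_single, lp.inner_single_left, lp.coeFn_smul,
      Pi.smul_apply, lp.single_apply, Pi.single_apply]
    simp [eq_comm]
  rw [indexProj, finsum_mem_eq_finite_toFinset_sum _ hc, _root_.sum_apply, lp.coeFn_sum,
    Finset.sum_apply]
  simp only [term, Finset.sum_ite_eq', Set.Finite.mem_toFinset]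
  by_cases hβ : β ∈ c <;> simp [hβ]

theorem isDiagonal_indexProj_of_mem_classes (hc : c ∈ (S.indexSetoid N).classes) :
    IsDiagonal (S.indexProj c) (c.indicator 1) :=
  S.isDiagonal_indexProj (S.finite_of_mem_classes_indexSetoid hc)

theorem isMinimalProjection_iff_exists_indexProj :
    IsMinimalProjection (diagonalAlgebra (S.indexSetoid N)) P ↔
      ∃ c ∈ (S.indexSetoid N).classes, S.indexProj c = P := by
  rw [isMinimalProjection_diagonalAlgebra_iff]
  refine exists_congr fun c => and_congr_right fun hc => ?_
  have hdiag := S.isDiagonal_indexProj_of_mem_classes hc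
  exact ⟨hdiag.ext, fun h => h ▸ hdiag⟩

theorem bijOn_indexProj_classes (N : ℕ) :
    Set.BijOn S.indexProj (S.indexSetoid N).classes
      {P | IsMinimalProjection (diagonalAlgebra (S.indexSetoid N)) P} :=
  ⟨fun c hc => S.isMinimalProjection_iff_exists_indexProj.mpr ⟨c, hc, rfl⟩,
    fun _ hc _ hd h => ((S.isDiagonal_indexProj_of_mem_classes hc).indicator_eq_iff
      (S.isDiagonal_indexProj_of_mem_classes hd)).mp h,
    fun _ hP => S.isMinimalProjection_iff_exists_indexProj.mp hP⟩

theorem indexProj_le_energyProj_iff {E : ℂ} :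
    S.indexProj {α | S.indexSetoid N α α₀} ≤ S.energyProj N E ↔ (S.energy α₀ : ℂ) = E := by
  rw [(S.isDiagonal_indexProj_of_mem_classes ⟨α₀, rfl⟩).le_iff (S.isDiagonal_energyProj N E)]
  refine ⟨fun h => h ((S.indexSetoid N).refl α₀), fun h α hα => ?_⟩
  have energy_eq : S.energy α = S.energy α₀ := S.indexSetoid_le_ker_energy N hα
  rw [Set.mem_ofPred_eq, energy_eq, h]

theorem isMinimalProjection_and_le_energyProj_iff {E : ℂ} :
    IsMinimalProjection (diagonalAlgebra (S.indexSetoid N)) P ∧ P ≤ S.energyProj N E ↔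
      ∃ α₀ : Fin N → J, (S.Ψ α₀, E • S.Ψ α₀) ∈ S.hamiltonian N ∧
        P = S.indexProj {α | S.indexSetoid N α α₀} := by
  simp only [isMinimalProjection_iff_exists_indexProj, Ψ_mem_hamiltonian_iff]
  constructor
  · rintro ⟨⟨_, ⟨α₀, rfl⟩, rfl⟩, hle⟩
    exact ⟨α₀, S.indexProj_le_energyProj_iff.mp hle, rfl⟩
  · rintro ⟨α₀, hE, rfl⟩
    exact ⟨⟨_, ⟨α₀, rfl⟩, rfl⟩, S.indexProj_le_energyProj_iff.mpr hE⟩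

theorem exists_le_energyProj_of_isMinimalProjection
    (hP : IsMinimalProjection (diagonalAlgebra (S.indexSetoid N)) P) :
    ∃ E ∈ S.spec N, P ≤ S.energyProj N E := by
  obtain ⟨_, ⟨α₀, rfl⟩, rfl⟩ := S.isMinimalProjection_iff_exists_indexProj.mp hP
  exact ⟨S.energy α₀, S.energy_mem_spec α₀, S.indexProj_le_energyProj_iff.mpr rfl⟩

theorem forall_isMinimalProjection_energyProj_iff (N : ℕ) :
    (∀ E ∈ S.spec N,
        IsMinimalProjection (diagonalAlgebra (S.indexSetoid N)) (S.energyProj N E)) ↔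
      Setoid.ker S.energy ≤ S.indexSetoid N := by
  simp only [(S.isDiagonal_energyProj N _).isMinimalProjection_iff, spec_eq_range,
    Set.forall_mem_range, Complex.ofReal_inj]
  exact forall_preimage_mem_classes_iff (S.indexSetoid_le_ker_energy N)

theorem diagonalAlgebra_indexSetoid_eq_energyAlgebra_iff (N : ℕ) :
    diagonalAlgebra (S.indexSetoid N) = S.energyAlgebra N ↔
      Setoid.ker S.energy ≤ S.indexSetoid N := by
  rw [energyAlgebra_eq_diagonalAlgebra, diagonalAlgebra_injective.eq_iff]
  exact (S.indexSetoid_le_ker_energy N).ge_iff_eq.symm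

end Projections

end SingleParticle

end QuantumKac

end

theorem lemma2p14_general
    {H : Type*} [NormedAddCommGroup H] [InnerProductSpace ℂ H] [CompleteSpace H]
    {J : Type*} [LinearOrder J] [LocallyFiniteOrderBot J] (S : QuantumKac.SingleParticle H J)
    {𝒰 : Set (QuantumKac.TensorPower J 2 →L[ℂ] QuantumKac.TensorPower J 2)}
    (h𝒰 : Set.centralizer 𝒰 = S.energyAlgebra 2) {N : ℕ} (hN : 2 ≤ N) :
    (∀ c ∈ (S.indexSetoid N).classes, c.Finite) ∧
    (∀ E ∈ S.spec N, ∀ P : QuantumKac.TensorPower J N →L[ℂ] QuantumKac.TensorPower J N,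
      (QuantumKac.IsMinimalProjection (QuantumKac.pairCommutant 𝒰 N) P ∧ P ≤ S.energyProj N E) ↔
        ∃ α₀ : Fin N → J, (S.Ψ α₀, E • S.Ψ α₀) ∈ S.hamiltonian N ∧
          P = S.indexProj {α | (S.indexSetoid N) α α₀}) ∧
    (∀ P, QuantumKac.IsMinimalProjection (QuantumKac.pairCommutant 𝒰 N) P →
      ∃ E ∈ S.spec N, P ≤ S.energyProj N E) ∧
    Set.BijOn S.indexProj (S.indexSetoid N).classes
      {P | QuantumKac.IsMinimalProjection (QuantumKac.pairCommutant 𝒰 N) P} ∧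
    ((∀ E ∈ S.spec N,
        QuantumKac.IsMinimalProjection (QuantumKac.pairCommutant 𝒰 N) (S.energyProj N E)) ↔
      ∀ α α' : Fin N → J, S.energy α = S.energy α' → (S.indexSetoid N) α α') ∧
    (QuantumKac.pairCommutant 𝒰 N = S.energyAlgebra N ↔
      ∀ α α' : Fin N → J, S.energy α = S.energy α' → (S.indexSetoid N) α α') := by
  rw [S.pairCommutant_eq_diagonalAlgebra h𝒰 hN]
  exact ⟨fun _ => S.finite_of_mem_classes_indexSetoid,
    fun _ _ _ => S.isMinimalProjection_and_le_energyProj_iff,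
    fun _ => S.exists_le_energyProj_of_isMinimalProjection,
    S.bijOn_indexProj_classes N,
    S.forall_isMinimalProjection_energyProj_iff N,
    S.diagonalAlgebra_indexSetoid_eq_energyAlgebra_iff N⟩

theorem lemma2p14
    {H : Type*} [NormedAddCommGroup H] [InnerProductSpace ℂ H] [CompleteSpace H]
    {J : Type*} [LinearOrder J] [LocallyFiniteOrderBot J] (S : QuantumKac.SingleParticle H J)
    {C : Type*} [MetricSpace C] [CompactSpace C] [MeasurableSpace C] [BorelSpace C]
    (K : QuantumKac.CollisionSpecification S C) (hK : K.IsErgodic) (N : ℕ) (hN : 2 ≤ N) :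
    -- the equivalence classes are finite
    (∀ c ∈ (S.indexSetoid N).classes, c.Finite) ∧
    -- the minimal projections below `P_E`
    (∀ E ∈ S.spec N, ∀ P : QuantumKac.TensorPower J N →L[ℂ] QuantumKac.TensorPower J N,
      (QuantumKac.IsMinimalProjection (K.commutant N) P ∧ P ≤ S.energyProj N E) ↔
        ∃ α₀ : Fin N → J, (S.Ψ α₀, E • S.Ψ α₀) ∈ S.hamiltonian N ∧
          P = S.indexProj {α | (S.indexSetoid N) α α₀}) ∧
    -- each minimal projection lies below some `P_E`
    (∀ P, QuantumKac.IsMinimalProjection (K.commutant N) P →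
      ∃ E ∈ S.spec N, P ≤ S.energyProj N E) ∧
    -- minimal projections correspond one-to-one to equivalence classes
    Set.BijOn S.indexProj (S.indexSetoid N).classes
      {P | QuantumKac.IsMinimalProjection (K.commutant N) P} ∧
    -- full ergodicity
    (K.IsFullyErgodic N ↔
      ∀ α α' : Fin N → J, S.energy α = S.energy α' → (S.indexSetoid N) α α') ∧
    (K.commutant N = S.energyAlgebra N ↔
      ∀ α α' : Fin N → J, S.energy α = S.energy α' → (S.indexSetoid N) α α') := by
  simpa only [QuantumKac.CollisionSpecification.IsFullyErgodic, hK, true_and,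
    K.commutant_eq_pairCommutant] using lemma2p14_general S hK hN
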